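/- Let $m\ge 0$ be an integer, let $\mathbb F^+_m$ be the free semigroup with unit on generators $g_1,\dots,g_m$, and let $F^2_m=\bigoplus_{k\ge 0}(\mathbb C^m)^{\otimes k}$ be the full Fock space, with orthonormal basis $\{e_\alpha\}_{\alpha\in\mathbb F^+_m}$ and creation operators $S_i e_\alpha=e_{g_i\alpha}$, $i=1,\dots,m$. For a complex Hilbert space $\mathcal E$, the Hilbert tensor product $F^2_m\otimes\mathcal E$ is a module over the algebra $\mathbb F[Z_1,\dots,Z_m]$ of polynomials in $m$ noncommuting variables, with $Z_i$ acting as $S_i\otimes I_{\mathcal E}$. A bounded linear operator $\Theta:F^2_m\otimes\mathcal E\to F^2_m\otimes\mathcal E_*$ is called multi-analytic if $\Theta(S_i\otimes I_{\mathcal E})=(S_i\otimes I_{\mathcal E_*})\Theta$ for $i=1,\dots,m$. Two Hilbert modules are called similar if there is a bounded module map with bounded inverse from one onto the other. Theorem. Let $\mathcal E$ and $\mathcal E_*$ be complex Hilbert spaces and let $\Theta:F^2_m\otimes\mathcal E\to F^2_m\otimes\mathcal E_*$ be a multi-analytic operator such that $\ker\Theta=\{0\}$ and $\operatorname{ran}\Theta$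 is closed. Then the quotient module $(F^2_m\otimes\mathcal E_*)/\operatorname{ran}\Theta$, on which $Z_i$ acts by the operator induced by $S_i\otimes I_{\mathcal E_*}$, is similar to $F^2_m\otimes\mathcal F$ for some complex Hilbert space $\mathcal F$ if and only if $\Theta\Psi\Theta=\Theta$ for some multi-analytic operator $\Psi:F^2_m\otimes\mathcal E_*\to F^2_m\otimes\mathcal E$. -/

import Mathlib

universe u v

noncomputable section

open scoped InnerProductSpace

/-- The free semigroup (with unit) on the generators `g_1, …, g_m`, i.e. the set of words. -/
abbrev Words (m : ℕ) : Type := FreeMonoid (Fin m)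

/-- The Hilbert space `F²_m ⊗ E`, where `F²_m` is the full Fock space with orthonormal basis
`e_α` (`α` a word), realised as the square-summable families of vectors of `E` indexed by words:
the family `(x_α)` stands for `∑ e_α ⊗ x_α`.  See `FockModule.tmul` and the facts after it. -/
abbrev FockModule (m : ℕ) (E : Type u) [NormedAddCommGroup E] : Type u :=
  lp (fun _ : Words m => E) 2

/-- The full Fock space `F²_m`. -/
abbrev FockSpace (m : ℕ) : Type := FockModule m ℂ

namespace FockModule

variable {m : ℕ} {E : Type u} [NormedAddCommGroup E]

theorem of_mul_injective (i : Fin m) :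
    Function.Injective (fun w : Words m => FreeMonoid.of i * w) :=
  fun _ _ h => mul_left_cancel h

/-- The family with value `f α` at `g_i α`, and `0` at words that do not begin with `g_i`. -/
def creationFun (i : Fin m) (f : Words m → E) : Words m → E :=
  Function.extend (fun w : Words m => FreeMonoid.of i * w) f 0

theorem creationFun_of_mul (i : Fin m) (f : Words m → E) (w : Words m) :
    creationFun i f (FreeMonoid.of i * w) = f w :=
  (of_mul_injective i).extend_apply _ _ _

theorem creationFun_of_not (i : Fin m) (f : Words m → E) (w : Words m)
    (hw : ¬ ∃ v, FreeMonoid.of i * v = w) : creationFun i f w = 0 :=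
  Function.extend_apply' _ _ _ hw

theorem hasSum_creationFun (i : Fin m) (f : FockModule m E) :
    HasSum (fun w => ‖creationFun i f w‖ ^ (2 : ENNReal).toReal)
      (‖f‖ ^ (2 : ENNReal).toReal) := by
  have h := lp.hasSum_norm (p := 2) (by norm_num) f
  rw [← (of_mul_injective i).hasSum_iff]
  · convert h using 2 with w
    simp [creationFun, (of_mul_injective i).extend_apply]
  · intro w hw
    have : creationFun i f w = 0 := Function.extend_apply' _ _ _ hw
    simp [this]

variable [InnerProductSpace ℂ E]

/-- The operator `S_i ⊗ I_E`, where `S_i` is the `i`-th creation operator (left shift)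
`S_i e_α = e_{g_i α}`; it is an isometry. -/
def creation (i : Fin m) : FockModule m E →ₗᵢ[ℂ] FockModule m E where
  toFun f := ⟨creationFun i f,
    (memℓp_gen_iff (by norm_num)).2 (hasSum_creationFun i f).summable⟩
  map_add' f g := by
    ext w
    change creationFun i (f + g : Words m → E) w = creationFun i f w + creationFun i g w
    by_cases hw : ∃ v, FreeMonoid.of i * v = w
    · obtain ⟨v, rfl⟩ := hw
      simp only [creationFun_of_mul, Pi.add_apply]
    · simp only [creationFun_of_not _ _ _ hw, add_zero]
  map_smul' c f := by
    ext w
    change creationFun i (c • f : Words m → E) w = c • creationFun i f w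
    by_cases hw : ∃ v, FreeMonoid.of i * v = w
    · obtain ⟨v, rfl⟩ := hw
      simp only [creationFun_of_mul, Pi.smul_apply]
    · simp only [creationFun_of_not _ _ _ hw, smul_zero]
  norm_map' f := by
    have h := lp.norm_eq_tsum_rpow (p := 2) (by norm_num)
      (⟨creationFun i f, (memℓp_gen_iff (by norm_num)).2 (hasSum_creationFun i f).summable⟩ :
        FockModule m E)
    refine h.trans ?_
    rw [(hasSum_creationFun i f).tsum_eq, ← Real.rpow_mul (norm_nonneg _)]
    simp

theorem creation_apply_of_mul (i : Fin m) (f : FockModule m E) (w : Words m) :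
    creation i f (FreeMonoid.of i * w) = f w :=
  (of_mul_injective i).extend_apply _ _ _

theorem creation_apply_of_forall_ne (i : Fin m) (f : FockModule m E) (w : Words m)
    (hw : ∀ v, FreeMonoid.of i * v ≠ w) : creation i f w = 0 :=
  Function.extend_apply' _ _ _ fun ⟨v, hv⟩ => hw v hv

/-- The elementary tensor `f ⊗ x` of `f ∈ F²_m` and `x ∈ E`. -/
def tmul (f : FockSpace m) (x : E) : FockModule m E :=
  ⟨fun w => f w • x, by
    have h := (lp.memℓp f).summable (by norm_num)
    refine (memℓp_gen_iff (by norm_num)).2 ?_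
    simpa [norm_smul, mul_pow] using h.mul_right (‖x‖ ^ (2 : ENNReal).toReal)⟩

/-- `⟨f ⊗ x, g ⊗ y⟩ = ⟨f, g⟩ ⟨x, y⟩`. -/
theorem inner_tmul (f g : FockSpace m) (x y : E) :
    ⟪tmul f x, tmul g y⟫_ℂ = ⟪f, g⟫_ℂ * ⟪x, y⟫_ℂ := by
  rw [lp.inner_eq_tsum, lp.inner_eq_tsum, ← tsum_mul_right]
  refine tsum_congr fun w => ?_
  simp only [tmul, inner_smul_left, inner_smul_right, RCLike.inner_apply]
  ring

/-- The elementary tensors span a dense subspace. -/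
theorem dense_span_tmul :
    (Submodule.span ℂ {t : FockModule m E | ∃ f x, t = tmul f x}).topologicalClosure = ⊤ := by
  classical
  rw [eq_top_iff]
  intro f _
  have h := lp.hasSum_single (p := 2) (by norm_num) f
  refine mem_closure_of_tendsto h (Filter.Eventually.of_forall fun s => ?_)
  refine Submodule.sum_mem _ fun w _ => Submodule.subset_span ⟨lp.single 2 w 1, f w, ?_⟩
  ext v
  by_cases hv : v = w
  · subst hv; simp [tmul]
  · simp [tmul, Pi.single_apply, hv]

/-- `(S_i ⊗ I) (f ⊗ x) = S_i f ⊗ x`. -/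
theorem creation_tmul (i : Fin m) (f : FockSpace m) (x : E) :
    creation i (tmul f x) = tmul (creation i f) x := by
  ext w
  by_cases hw : ∃ v, FreeMonoid.of i * v = w
  · obtain ⟨v, rfl⟩ := hw
    simp [creation_apply_of_mul, tmul]
  · have hw' : ∀ v, FreeMonoid.of i * v ≠ w := fun v hv => hw ⟨v, hv⟩
    simp [creation_apply_of_forall_ne _ _ _ hw', tmul]

end FockModule

open FockModule

/-- A bounded operator `Θ : F²_m ⊗ E → F²_m ⊗ E'` is multi-analytic if
`Θ (S_i ⊗ I_E) = (S_i ⊗ I_{E'}) Θ` for `i = 1, …, m`. -/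
def IsMultiAnalytic {m : ℕ} {E : Type u} {E' : Type v}
    [NormedAddCommGroup E] [InnerProductSpace ℂ E]
    [NormedAddCommGroup E'] [InnerProductSpace ℂ E']
    (Θ : FockModule m E →L[ℂ] FockModule m E') : Prop :=
  ∀ i : Fin m, Θ ∘L (creation i).toContinuousLinearMap =
    (creation i).toContinuousLinearMap ∘L Θ

/-- The operator that a bounded operator `T` on `H` with `T N ⊆ N` induces on `H ⧸ N`:
`T (h + N) = T h + N`. -/
def quotientOperator {H : Type u} [NormedAddCommGroup H] [NormedSpace ℂ H]
    (N : Submodule ℂ H) (T : H →L[ℂ] H) (hT : ∀ h ∈ N, T h ∈ N) : (H ⧸ N) →L[ℂ] (H ⧸ N) where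
  toLinearMap := N.mapQ N T.toLinearMap hT
  cont := by
    refine continuous_quot_lift _ ?_
    exact continuous_quot_mk.comp T.continuous

/-- The range of a multi-analytic operator is invariant under the operators `S_i ⊗ I`. -/
theorem IsMultiAnalytic.creation_mem_range {m : ℕ} {E : Type u} {E' : Type v}
    [NormedAddCommGroup E] [InnerProductSpace ℂ E]
    [NormedAddCommGroup E'] [InnerProductSpace ℂ E']
    {Θ : FockModule m E →L[ℂ] FockModule m E'} (hΘ : IsMultiAnalytic Θ) (i : Fin m) :
    ∀ h ∈ LinearMap.range Θ.toLinearMap,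
      (creation i).toContinuousLinearMap h ∈ LinearMap.range Θ.toLinearMap := by
  rintro _ ⟨f, rfl⟩
  exact ⟨creation i f, DFunLike.congr_fun (hΘ i) f⟩

/-- Two Hilbert modules over `𝔽[Z_1, …, Z_m]`, given by the operators `T i` on `H` and `T' i` on
`K` by which the coordinates act, are similar if there is a bounded module map `H → K` with a
bounded inverse. -/
def ModulesSimilar {m : ℕ} {H : Type u} {K : Type v}
    [AddCommGroup H] [Module ℂ H] [TopologicalSpace H]
    [AddCommGroup K] [Module ℂ K] [TopologicalSpace K]
    (T : Fin m → H →L[ℂ] H) (T' : Fin m → K →L[ℂ] K) : Prop :=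
  ∃ X : H ≃L[ℂ] K, ∀ (i : Fin m) (h : H), X (T i h) = T' i (X h)

end

/-!
Since `Θ` is injective with closed range, it is an isomorphism onto `N = ran Θ`, and
`Θ Ψ Θ = Θ` means `Ψ Θ = 1`.  Both sides of the equivalence express that `N` has a complementary
submodule in `F²_m ⊗ E'`.

If `Ψ Θ = 1`, then `1 - Θ Ψ` is a projection with kernel `N` onto the closed submodule `ker Ψ`, so
the quotient by `N` is similar to `ker Ψ`.  By the Wold decomposition of the row isometry
`(S_1, …, S_m)` restricted to `ker Ψ`, this submodule is unitarily equivalent to `F²_m ⊗ W`, where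
`W` is its wandering subspace (`FockModule.exists_isometry_range_eq`).

Conversely, a similarity of the quotient with `F²_m ⊗ F` amounts to a surjective multi-analytic
operator `R : F²_m ⊗ E' → F²_m ⊗ F` with kernel `N`.  The point is that `R` has a right inverse `Y`
that is again multi-analytic (`IsMultiAnalytic.exists_rightInverse`); then `1 - Y R` is a projection
onto `N`, and `Ψ = Θ⁻¹ (1 - Y R)`.  A bounded right inverse of `R` on the vacuum space `e_1 ⊗ F`
(`1` the empty word) extends to a module map on finite sums, but that extension need not be
bounded.  A bounded one is found by the lurking isometry method: surjectivity gives `R R^* ≥ c²`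
with `c > 0`, and since `R` commutes with the shifts, the positive operator `R R^* - c²` satisfies
an energy identity that defines a contractive transition map of a linear system indexed by words.
The transfer operator of the system (`truncatedSystem`, `exists_transferOperator`) is bounded,
intertwines the backward shifts, and sends `R^* h` to `c h`; up to the factor `c` its adjoint
is `Y`.
-/

open scoped InnerProductSpace
open FockModule

/-! ### Words, monomials and backward shifts -/

namespace FockModule

variable {m : ℕ}

theorem words_cases (w : Words m) : w = 1 ∨ ∃ i v, w = FreeMonoid.of i * v := by
  induction w using FreeMonoid.casesOn with
  | one => exact Or.inl rfl
  | of_mul i v => exact Or.inr ⟨i, v, rfl⟩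

theorem of_mul_ne_one (i : Fin m) (w : Words m) : FreeMonoid.of i * w ≠ 1 := fun h => by
  simpa using congrArg FreeMonoid.length h

theorem of_mul_ne_of_mul {i j : Fin m} (hij : i ≠ j) (v w : Words m) :
    FreeMonoid.of i * v ≠ FreeMonoid.of j * w := fun h => hij <| by
  have := congrArg FreeMonoid.toList h
  simp only [FreeMonoid.toList_of_mul, List.cons.injEq] at this
  exact this.1

variable {E : Type u} [NormedAddCommGroup E]

theorem add_apply (f g : FockModule m E) (w : Words m) : (f + g) w = f w + g w := rfl

/-- The families that vanish at all words of length at least `n`. -/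
def degreeLT (n : ℕ) : Set (FockModule m E) := {f | ∀ w : Words m, n ≤ w.length → f w = 0}

theorem eq_zero_of_mem_degreeLT_zero {f : FockModule m E} (hf : f ∈ degreeLT 0) : f = 0 := by
  ext w
  exact hf w (Nat.zero_le _)

variable [InnerProductSpace ℂ E]

/-- The evaluation of a family at a fixed word, as a bounded operator. -/
noncomputable def coord (w : Words m) : FockModule m E →L[ℂ] E := lp.evalCLM ℂ (fun _ => E) 2 w

theorem coord_apply (w : Words m) (f : FockModule m E) : coord w f = f w := rfl

open Classical in
/-- The operator `x ↦ e_w ⊗ x`. -/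
noncomputable def monomial (w : Words m) : E →L[ℂ] FockModule m E :=
  lp.singleContinuousLinearMap ℂ (fun _ => E) 2 w

theorem monomial_apply_self (w : Words m) (x : E) : monomial w x w = x := by
  classical
  exact lp.single_apply_self (E := fun _ : Words m => E) 2 w x

theorem monomial_apply_of_ne {v w : Words m} (h : v ≠ w) (x : E) : monomial w x v = 0 := by
  classical
  exact lp.single_apply_ne (E := fun _ : Words m => E) 2 w x h

theorem inner_monomial_left (w : Words m) (x : E) (f : FockModule m E) :
    ⟪monomial w x, f⟫_ℂ = ⟪x, f w⟫_ℂ := by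
  classical
  exact lp.inner_single_left (𝕜 := ℂ) (G := fun _ : Words m => E) w x f

theorem hasSum_monomial (f : FockModule m E) : HasSum (fun w => monomial w (f w)) f := by
  classical
  exact lp.hasSum_single (p := 2) (by norm_num) f

theorem creation_apply_one (i : Fin m) (f : FockModule m E) : creation i f 1 = 0 :=
  creation_apply_of_forall_ne i f 1 (of_mul_ne_one i)

theorem creation_apply_of_ne {i j : Fin m} (hij : i ≠ j) (f : FockModule m E) (w : Words m) :
    creation i f (FreeMonoid.of j * w) = 0 :=
  creation_apply_of_forall_ne i f _ fun v => of_mul_ne_of_mul hij v w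

theorem creation_monomial (i : Fin m) (w : Words m) (x : E) :
    creation i (monomial w x) = monomial (FreeMonoid.of i * w) x := by
  ext v
  rcases words_cases v with rfl | ⟨j, v, rfl⟩
  · rw [creation_apply_one, monomial_apply_of_ne (of_mul_ne_one i w).symm]
  · by_cases hij : i = j
    · subst hij
      rw [creation_apply_of_mul]
      by_cases hv : v = w
      · subst hv
        rw [monomial_apply_self, monomial_apply_self]
      · rw [monomial_apply_of_ne hv, monomial_apply_of_ne fun h => hv (mul_left_cancel h)]
    · rw [creation_apply_of_ne hij, monomial_apply_of_ne (of_mul_ne_of_mul (Ne.symm hij) v w)]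

theorem sum_creation_apply_one (g : Fin m → FockModule m E) :
    (∑ i, creation i (g i)) 1 = 0 := by
  rw [← coord_apply, map_sum]
  exact Finset.sum_eq_zero fun i _ => creation_apply_one i _

theorem monomial_add_sum_creation_apply_one (x : E) (g : Fin m → FockModule m E) :
    (monomial 1 x + ∑ i, creation i (g i) : FockModule m E) 1 = x := by
  rw [add_apply, sum_creation_apply_one, monomial_apply_self, add_zero]

theorem dense_iUnion_degreeLT : Dense (⋃ n, degreeLT n : Set (FockModule m E)) := fun f => by
  refine mem_closure_of_tendsto (hasSum_monomial f) (Filter.Eventually.of_forall fun s => ?_)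
  refine Set.mem_iUnion.2 ⟨s.sup FreeMonoid.length + 1, fun w hw => ?_⟩
  rw [← coord_apply, map_sum]
  refine Finset.sum_eq_zero fun v hv => monomial_apply_of_ne ?_ _
  rintro rfl
  have := Finset.le_sup (f := FreeMonoid.length) hv
  omega

variable [CompleteSpace E]

/-- The backward shift `S_i^* ⊗ I_E`. -/
noncomputable def annihilation (i : Fin m) : FockModule m E →L[ℂ] FockModule m E :=
  ContinuousLinearMap.adjoint (creation i).toContinuousLinearMap

theorem inner_annihilation_right (i : Fin m) (f g : FockModule m E) :
    ⟪f, annihilation i g⟫_ℂ = ⟪creation i f, g⟫_ℂ :=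
  ContinuousLinearMap.adjoint_inner_right _ _ _

theorem annihilation_apply (i : Fin m) (f : FockModule m E) (w : Words m) :
    annihilation i f w = f (FreeMonoid.of i * w) := by
  refine ext_inner_left ℂ fun x : E => ?_
  rw [← inner_monomial_left, inner_annihilation_right, creation_monomial, inner_monomial_left]

theorem annihilation_creation (i : Fin m) (f : FockModule m E) :
    annihilation i (creation i f) = f := by
  ext w
  rw [annihilation_apply, creation_apply_of_mul]

theorem annihilation_creation_of_ne {i j : Fin m} (hij : i ≠ j) (f : FockModule m E) :
    annihilation j (creation i f) = 0 := by
  ext w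
  rw [annihilation_apply, creation_apply_of_ne hij]
  rfl

theorem annihilation_sum_creation (j : Fin m) (g : Fin m → FockModule m E) :
    annihilation j (∑ i, creation i (g i)) = g j := by
  rw [map_sum, Finset.sum_eq_single j, annihilation_creation]
  · exact fun i _ hij => annihilation_creation_of_ne hij _
  · simp

theorem monomial_add_sum_creation (f : FockModule m E) :
    monomial 1 (f 1) + ∑ i, creation i (annihilation i f) = f := by
  ext w
  rcases words_cases w with rfl | ⟨j, w, rfl⟩
  · exact monomial_add_sum_creation_apply_one _ _
  · rw [add_apply, ← annihilation_apply j (∑ i, _), annihilation_sum_creation,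
      monomial_apply_of_ne (of_mul_ne_one j w), zero_add, annihilation_apply]

/-- Parseval's identity for the splitting of `F²_m ⊗ E` into `e_1 ⊗ E`, where `1` is the empty
word, and the orthogonal ranges of the operators `S_i ⊗ I_E`. -/
theorem norm_sq_eq (f : FockModule m E) :
    ‖f‖ ^ 2 = ‖f 1‖ ^ 2 + ∑ i, ‖annihilation i f‖ ^ 2 := by
  have h : ⟪f, f⟫_ℂ = ⟪f 1, f 1⟫_ℂ + ∑ i, ⟪annihilation i f, annihilation i f⟫_ℂ := by
    nth_rw 1 [← monomial_add_sum_creation f]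
    rw [inner_add_left, inner_monomial_left, sum_inner]
    simp only [inner_annihilation_right]
  simp only [inner_self_eq_norm_sq_to_K] at h
  exact_mod_cast h

theorem annihilation_monomial_one (j : Fin m) (x : E) :
    annihilation j (monomial 1 x : FockModule m E) = 0 := by
  ext w
  rw [annihilation_apply, monomial_apply_of_ne (of_mul_ne_one j w)]
  rfl

theorem annihilation_monomial_add_sum_creation (j : Fin m) (x : E)
    (g : Fin m → FockModule m E) :
    annihilation j (monomial 1 x + ∑ i, creation i (g i)) = g j := by
  rw [map_add, annihilation_sum_creation, annihilation_monomial_one, zero_add]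

theorem norm_sq_monomial_add_sum_creation (x : E) (g : Fin m → FockModule m E) :
    ‖(monomial 1 x + ∑ i, creation i (g i) : FockModule m E)‖ ^ 2 = ‖x‖ ^ 2 + ∑ i, ‖g i‖ ^ 2 := by
  rw [norm_sq_eq, monomial_add_sum_creation_apply_one]
  simp only [annihilation_monomial_add_sum_creation]

theorem annihilation_mem_degreeLT {n : ℕ} {f : FockModule m E} (hf : f ∈ degreeLT (n + 1))
    (i : Fin m) : annihilation i f ∈ degreeLT n := fun w hw => by
  rw [annihilation_apply]
  refine hf _ ?_
  rw [FreeMonoid.length_mul, FreeMonoid.length_of]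
  omega

end FockModule

theorem isMultiAnalytic_iff {m : ℕ} {E : Type u} {E' : Type v}
    [NormedAddCommGroup E] [InnerProductSpace ℂ E]
    [NormedAddCommGroup E'] [InnerProductSpace ℂ E']
    {Θ : FockModule m E →L[ℂ] FockModule m E'} :
    IsMultiAnalytic Θ ↔ ∀ i f, Θ (creation i f) = creation i (Θ f) :=
  ⟨fun h i f => DFunLike.congr_fun (h i) f, fun h i => ContinuousLinearMap.ext (h i)⟩

/-- Multi-analytic operators are those whose adjoints intertwine the backward shifts. -/
theorem isMultiAnalytic_iff_adjoint {m : ℕ} {E : Type u} {E' : Type v}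
    [NormedAddCommGroup E] [InnerProductSpace ℂ E] [CompleteSpace E]
    [NormedAddCommGroup E'] [InnerProductSpace ℂ E'] [CompleteSpace E']
    {Θ : FockModule m E →L[ℂ] FockModule m E'} :
    IsMultiAnalytic Θ ↔ ∀ i f, ContinuousLinearMap.adjoint Θ (annihilation i f) =
      annihilation i (ContinuousLinearMap.adjoint Θ f) := by
  rw [isMultiAnalytic_iff]
  refine forall_congr' fun i => ⟨fun h f => ext_inner_left ℂ fun g => ?_,
    fun h f => ext_inner_right ℂ fun g => ?_⟩
  · rw [ContinuousLinearMap.adjoint_inner_right, inner_annihilation_right,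
      inner_annihilation_right, ContinuousLinearMap.adjoint_inner_right, h]
  · rw [← ContinuousLinearMap.adjoint_inner_right, ← inner_annihilation_right, ← h,
      ContinuousLinearMap.adjoint_inner_right, inner_annihilation_right]

/-! ### Factorization through contractions -/

/-- A form of Douglas' lemma: if `‖b v‖ ≤ ‖a v‖` for all `v`, then `b` factors through `a` by a
contraction.  It is defined on the closure of the range of `a` and is zero on the orthogonal
complement. -/
theorem exists_contraction_of_norm_le {V H₁ H₂ : Type*} [AddCommGroup V] [Module ℂ V]
    [NormedAddCommGroup H₁] [InnerProductSpace ℂ H₁] [CompleteSpace H₁]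
    [NormedAddCommGroup H₂] [InnerProductSpace ℂ H₂] [CompleteSpace H₂]
    (a : V →ₗ[ℂ] H₁) (b : V →ₗ[ℂ] H₂) (h : ∀ v, ‖b v‖ ≤ ‖a v‖) :
    ∃ U : H₁ →L[ℂ] H₂, (∀ x, ‖U x‖ ≤ ‖x‖) ∧ ∀ v, U (a v) = b v := by
  let K : Submodule ℂ H₁ := (LinearMap.range a).topologicalClosure
  have : CompleteSpace K :=
    (Submodule.isClosed_topologicalClosure (LinearMap.range a)).completeSpace_coe
  let e : V →ₗ[ℂ] K := a.codRestrict K fun v =>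
    Submodule.le_topologicalClosure _ (LinearMap.mem_range_self a v)
  have he : DenseRange e := by
    intro x
    have hrange : (Subtype.val '' Set.range e : Set H₁) = LinearMap.range a := by
      rw [← Set.range_comp]
      rfl
    rw [closure_subtype, hrange]
    exact x.2
  have hbound : ∀ v, ‖b v‖ ≤ 1 * ‖e v‖ := fun v => by simpa [e] using h v
  refine ⟨b.extendOfNorm e ∘L K.orthogonalProjectionOnto, fun x => ?_, fun v => ?_⟩
  · calc _ ≤ 1 * ‖K.orthogonalProjectionOnto x‖ :=
          LinearMap.norm_extendOfNorm_apply_le he 1 hbound _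
      _ ≤ ‖x‖ := by
          rw [one_mul]
          exact K.norm_orthogonalProjectionOnto_apply_le x
  · have : K.orthogonalProjectionOnto (a v) = e v :=
      Submodule.orthogonalProjectionOnto_mem_subspace_eq_self (e v)
    rw [ContinuousLinearMap.comp_apply, this]
    exact LinearMap.extendOfNorm_eq he ⟨1, hbound⟩ v

/-- The version of `exists_contraction_of_norm_le` for a map between Hilbert sums
`L ⊕ ⋯ ⊕ L ⊕ E → L ⊕ F`, given by its two components.  The product spaces in the statement carry
the supremum norm, so the contractivity is written out with squares. -/
theorem exists_contraction_pair_of_norm_sq_le {m : ℕ} {V L E F : Type*}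
    [AddCommGroup V] [Module ℂ V]
    [NormedAddCommGroup L] [InnerProductSpace ℂ L] [CompleteSpace L]
    [NormedAddCommGroup E] [InnerProductSpace ℂ E] [CompleteSpace E]
    [NormedAddCommGroup F] [InnerProductSpace ℂ F] [CompleteSpace F]
    (x : V →ₗ[ℂ] (Fin m → L)) (a : V →ₗ[ℂ] E) (y : V →ₗ[ℂ] L) (b : V →ₗ[ℂ] F)
    (h : ∀ v, ‖y v‖ ^ 2 + ‖b v‖ ^ 2 ≤ ∑ i, ‖x v i‖ ^ 2 + ‖a v‖ ^ 2) :
    ∃ (U₁ : ((Fin m → L) × E) →L[ℂ] L) (U₂ : ((Fin m → L) × E) →L[ℂ] F),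
      (∀ p, ‖U₁ p‖ ^ 2 + ‖U₂ p‖ ^ 2 ≤ ∑ i, ‖p.1 i‖ ^ 2 + ‖p.2‖ ^ 2) ∧
        ∀ v, U₁ (x v, a v) = y v ∧ U₂ (x v, a v) = b v := by
  let j : ((Fin m → L) × E) →L[ℂ] WithLp 2 (PiLp 2 (fun _ : Fin m => L) × E) :=
    ((PiLp.continuousLinearEquiv 2 ℂ (fun _ : Fin m => L)).symm.prodCongr
      (.refl ℂ E)).trans
      (WithLp.prodContinuousLinearEquiv 2 ℂ (PiLp 2 (fun _ : Fin m => L)) E).symm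
  let q := WithLp.prodContinuousLinearEquiv 2 ℂ L F
  have hj : ∀ p, ‖j p‖ ^ 2 = ∑ i, ‖p.1 i‖ ^ 2 + ‖p.2‖ ^ 2 := fun p => by
    rw [WithLp.prod_norm_sq_eq_of_L2, PiLp.norm_sq_eq_of_L2]
    rfl
  have hq : ∀ z, ‖z‖ ^ 2 = ‖(q z).1‖ ^ 2 + ‖(q z).2‖ ^ 2 := fun z =>
    WithLp.prod_norm_sq_eq_of_L2 z
  obtain ⟨U, hU, hU'⟩ := exists_contraction_of_norm_le (j.toLinearMap ∘ₗ x.prod a)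
    (q.symm.toLinearMap ∘ₗ y.prod b) fun v => by
      refine le_of_sq_le_sq ?_ (norm_nonneg _)
      rw [hq]
      simpa [hj] using h v
  refine ⟨ContinuousLinearMap.fst ℂ L F ∘L q.toContinuousLinearMap ∘L U ∘L j,
    ContinuousLinearMap.snd ℂ L F ∘L q.toContinuousLinearMap ∘L U ∘L j, fun p => ?_, fun v => ?_⟩
  · rw [← hj]
    refine (hq (U (j p))).symm.le.trans ?_
    gcongr
    exact hU _
  · have := congrArg q (hU' v)
    simp only [LinearMap.comp_apply] at this
    have h2 : q (U (j (x v, a v))) = (y v, b v) := by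
      refine this.trans ?_
      simp
    exact ⟨congrArg Prod.fst h2, congrArg Prod.snd h2⟩

/-! ### Transfer operators of linear systems indexed by words -/

section Realization

variable {m : ℕ} {L : Type*} {E : Type u} {F : Type v}
    [NormedAddCommGroup L] [InnerProductSpace ℂ L]
    [NormedAddCommGroup E] [InnerProductSpace ℂ E] [CompleteSpace E]
    [NormedAddCommGroup F] [InnerProductSpace ℂ F]
    (U₁ : ((Fin m → L) × E) →L[ℂ] L) (U₂ : ((Fin m → L) × E) →L[ℂ] F)

/-- The linear system with state space `L`, input space `E`, output space `F` and transition maps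
`U₁` (next state) and `U₂` (output) runs over the tree of words from the words of length `n`,
where the state is zero, back to the empty word.  The first component sends an input
`f ∈ F²_m ⊗ E` to the state reached at the empty word, the second one to the family of outputs at
the words of length less than `n`. -/
noncomputable def truncatedSystem :
    ℕ → (FockModule m E →L[ℂ] L) × (FockModule m E →L[ℂ] FockModule m F)
  | 0 => (0, 0)
  | n + 1 =>
    let input : FockModule m E →L[ℂ] (Fin m → L) × E :=
      (ContinuousLinearMap.pi fun i => (truncatedSystem n).1 ∘L annihilation i).prod (coord 1)
    (U₁ ∘L input, monomial 1 ∘L U₂ ∘L input +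
      ∑ i, (creation i).toContinuousLinearMap ∘L (truncatedSystem n).2 ∘L annihilation i)

theorem truncatedSystem_succ_fst (n : ℕ) (f : FockModule m E) :
    (truncatedSystem U₁ U₂ (n + 1)).1 f =
      U₁ (fun i => (truncatedSystem U₁ U₂ n).1 (annihilation i f), f 1) := rfl

theorem truncatedSystem_succ_snd (n : ℕ) (f : FockModule m E) :
    (truncatedSystem U₁ U₂ (n + 1)).2 f =
      monomial 1 (U₂ (fun i => (truncatedSystem U₁ U₂ n).1 (annihilation i f), f 1)) +
        ∑ i, creation i ((truncatedSystem U₁ U₂ n).2 (annihilation i f)) := by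
  simp only [truncatedSystem, _root_.add_apply, sum_apply]
  rfl

/-- On inputs of degree less than `n` the truncations from the `n`-th on agree. -/
theorem truncatedSystem_stable {n k : ℕ} (hnk : n ≤ k) {f : FockModule m E}
    (hf : f ∈ degreeLT n) :
      (truncatedSystem U₁ U₂ k).1 f = (truncatedSystem U₁ U₂ n).1 f ∧
      (truncatedSystem U₁ U₂ k).2 f = (truncatedSystem U₁ U₂ n).2 f := by
  induction n generalizing k f with
  | zero =>
    rw [eq_zero_of_mem_degreeLT_zero hf]
    simp
  | succ n ih =>
    obtain ⟨k, rfl⟩ := Nat.exists_eq_add_of_lt (Nat.lt_of_succ_le hnk)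
    have h1 := fun i => (ih (k := n + k) (by omega) (annihilation_mem_degreeLT hf i)).1
    have h2 := fun i => (ih (k := n + k) (by omega) (annihilation_mem_degreeLT hf i)).2
    simp only [truncatedSystem_succ_fst, truncatedSystem_succ_snd, h1, h2, and_self]

variable [CompleteSpace F]

theorem annihilation_truncatedSystem_succ (n : ℕ) (i : Fin m) (f : FockModule m E) :
    annihilation i ((truncatedSystem U₁ U₂ (n + 1)).2 f) =
      (truncatedSystem U₁ U₂ n).2 (annihilation i f) := by
  rw [truncatedSystem_succ_snd, annihilation_monomial_add_sum_creation]

/-- Contractivity of the transition map yields an energy balance for the whole run. -/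
theorem norm_sq_truncatedSystem_le
    (hU : ∀ p, ‖U₁ p‖ ^ 2 + ‖U₂ p‖ ^ 2 ≤ ∑ i, ‖p.1 i‖ ^ 2 + ‖p.2‖ ^ 2) (n : ℕ)
    (f : FockModule m E) :
    ‖(truncatedSystem U₁ U₂ n).1 f‖ ^ 2 + ‖(truncatedSystem U₁ U₂ n).2 f‖ ^ 2 ≤ ‖f‖ ^ 2 := by
  induction n generalizing f with
  | zero => simp [truncatedSystem]
  | succ n ih =>
    rw [truncatedSystem_succ_fst, truncatedSystem_succ_snd, norm_sq_monomial_add_sum_creation,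
      norm_sq_eq f]
    have h1 := hU (fun i => (truncatedSystem U₁ U₂ n).1 (annihilation i f), f 1)
    have h2 := Finset.sum_le_sum fun i (_ : i ∈ Finset.univ) => ih (annihilation i f)
    rw [Finset.sum_add_distrib] at h2
    dsimp only at h1
    linarith

theorem norm_truncatedSystem_snd_le
    (hU : ∀ p, ‖U₁ p‖ ^ 2 + ‖U₂ p‖ ^ 2 ≤ ∑ i, ‖p.1 i‖ ^ 2 + ‖p.2‖ ^ 2) (n : ℕ)
    (f : FockModule m E) : ‖(truncatedSystem U₁ U₂ n).2 f‖ ≤ ‖f‖ := by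
  refine le_of_sq_le_sq ?_ (norm_nonneg _)
  have := norm_sq_truncatedSystem_le U₁ U₂ hU n f
  nlinarith [sq_nonneg ‖(truncatedSystem U₁ U₂ n).1 f‖]

/-- The truncations stabilise on the dense set of inputs of finite degree and are uniformly
bounded, so they converge strongly. -/
theorem cauchySeq_truncatedSystem
    (hU : ∀ p, ‖U₁ p‖ ^ 2 + ‖U₂ p‖ ^ 2 ≤ ∑ i, ‖p.1 i‖ ^ 2 + ‖p.2‖ ^ 2)
    (f : FockModule m E) : CauchySeq fun n => (truncatedSystem U₁ U₂ n).2 f := by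
  rw [Metric.cauchySeq_iff']
  intro ε hε
  obtain ⟨g, hg, hfg⟩ := Metric.mem_closure_iff.1 (dense_iUnion_degreeLT f) (ε / 2) (by positivity)
  obtain ⟨N, hN⟩ := Set.mem_iUnion.1 hg
  refine ⟨N, fun n hn => ?_⟩
  have h : (truncatedSystem U₁ U₂ n).2 f - (truncatedSystem U₁ U₂ N).2 f =
      (truncatedSystem U₁ U₂ n).2 (f - g) - (truncatedSystem U₁ U₂ N).2 (f - g) := by
    rw [map_sub, map_sub, (truncatedSystem_stable U₁ U₂ hn hN).2]
    abel
  rw [dist_eq_norm] at hfg ⊢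
  rw [h]
  calc _ ≤ ‖(truncatedSystem U₁ U₂ n).2 (f - g)‖ + ‖(truncatedSystem U₁ U₂ N).2 (f - g)‖ :=
        norm_sub_le _ _
    _ ≤ ‖f - g‖ + ‖f - g‖ := add_le_add (norm_truncatedSystem_snd_le U₁ U₂ hU _ _)
        (norm_truncatedSystem_snd_le U₁ U₂ hU _ _)
    _ < ε := by linarith

/-- The strong limit of the truncations intertwines the backward shifts, because the outputs at
the words that begin with `g_i` depend only on the inputs there. -/
theorem exists_transferOperator
    (hU : ∀ p, ‖U₁ p‖ ^ 2 + ‖U₂ p‖ ^ 2 ≤ ∑ i, ‖p.1 i‖ ^ 2 + ‖p.2‖ ^ 2) :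
    ∃ C : FockModule m E →L[ℂ] FockModule m F,
      (∀ i f, C (annihilation i f) = annihilation i (C f)) ∧
      ∀ f, Filter.Tendsto (fun n => (truncatedSystem U₁ U₂ n).2 f) Filter.atTop (nhds (C f)) := by
  choose c hc using fun f => cauchySeq_tendsto_of_complete (cauchySeq_truncatedSystem U₁ U₂ hU f)
  refine ⟨continuousLinearMapOfTendsto (fun n => (truncatedSystem U₁ U₂ n).2)
    (tendsto_pi_nhds.2 hc), fun i f => ?_, hc⟩
  refine tendsto_nhds_unique (hc (annihilation i f)) ?_
  simp only [← annihilation_truncatedSystem_succ]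
  exact ((annihilation i).continuous.tendsto _).comp ((Filter.tendsto_add_atTop_iff_nat 1).2 (hc f))

end Realization

/-! ### Multi-analytic right inverses -/

theorem ContinuousLinearMap.exists_norm_le_mul_norm_adjoint_of_surjective {H G : Type*}
    [NormedAddCommGroup H] [InnerProductSpace ℂ H] [CompleteSpace H]
    [NormedAddCommGroup G] [InnerProductSpace ℂ G] [CompleteSpace G]
    (R : H →L[ℂ] G) (hR : Function.Surjective R) :
    ∃ c : ℝ, 0 < c ∧ ∀ g, c * ‖g‖ ≤ ‖ContinuousLinearMap.adjoint R g‖ := by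
  obtain ⟨K, hK, h⟩ := R.exists_preimage_norm_le hR
  refine ⟨K⁻¹, inv_pos.2 hK, fun g => ?_⟩
  obtain ⟨x, rfl, hx⟩ := h g
  rw [inv_mul_le_iff₀ hK]
  rcases (norm_nonneg (R x)).eq_or_lt with h0 | h0
  · rw [← h0]; positivity
  refine le_of_mul_le_mul_right ?_ h0
  calc ‖R x‖ * ‖R x‖ = RCLike.re ⟪R x, R x⟫_ℂ := (inner_self_eq_norm_mul_norm _).symm
    _ = RCLike.re ⟪x, ContinuousLinearMap.adjoint R (R x)⟫_ℂ := by
        rw [ContinuousLinearMap.adjoint_inner_right]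
    _ ≤ ‖x‖ * ‖ContinuousLinearMap.adjoint R (R x)‖ := re_inner_le_norm _ _
    _ ≤ (K * ‖R x‖) * ‖ContinuousLinearMap.adjoint R (R x)‖ := by gcongr
    _ = _ := by ring

/-- If `T^* T ≥ c²`, then `T^* T - c² = M^* M` for some `M`, namely the positive square root. -/
theorem ContinuousLinearMap.exists_norm_sq_eq_sub {H G : Type*}
    [NormedAddCommGroup H] [InnerProductSpace ℂ H] [CompleteSpace H]
    [NormedAddCommGroup G] [InnerProductSpace ℂ G] [CompleteSpace G]
    (T : G →L[ℂ] H) (c : ℝ) (hc : 0 ≤ c) (hT : ∀ g, c * ‖g‖ ≤ ‖T g‖) :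
    ∃ M : G →L[ℂ] G, ∀ g, ‖M g‖ ^ 2 = ‖T g‖ ^ 2 - c ^ 2 * ‖g‖ ^ 2 := by
  let D : G →L[ℂ] G := ContinuousLinearMap.adjoint T ∘L T - ((c ^ 2 : ℝ) : ℂ) • 1
  have hD : ∀ g, RCLike.re ⟪D g, g⟫_ℂ = ‖T g‖ ^ 2 - c ^ 2 * ‖g‖ ^ 2 := fun g => by
    have : ⟪D g, g⟫_ℂ = ((‖T g‖ ^ 2 - c ^ 2 * ‖g‖ ^ 2 : ℝ) : ℂ) := by
      simp only [D, sub_apply, ContinuousLinearMap.comp_apply, inner_sub_left,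
        ContinuousLinearMap.adjoint_inner_left, inner_self_eq_norm_sq_to_K,
        smul_apply, one_apply_eq_self, inner_smul_left,
        Complex.conj_ofReal]
      push_cast
      rfl
    rw [this]
    exact Complex.ofReal_re _
  have hpos : 0 ≤ D := by
    rw [ContinuousLinearMap.nonneg_iff_isPositive, ContinuousLinearMap.isPositive_def']
    refine ⟨?_, fun g => ?_⟩
    · refine (ContinuousLinearMap.isPositive_adjoint_comp_self T).isSelfAdjoint.sub ?_
      exact IsSelfAdjoint.smul (Complex.conj_ofReal _) (IsSelfAdjoint.one _)
    · rw [ContinuousLinearMap.reApplyInnerSelf_apply, hD, ← mul_pow]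
      have := pow_le_pow_left₀ (by positivity) (hT g) 2
      linarith
  refine ⟨CFC.sqrt D, fun g => ?_⟩
  have hsa : ContinuousLinearMap.adjoint (CFC.sqrt D) = CFC.sqrt D :=
    (CFC.sqrt_nonneg D).isSelfAdjoint
  rw [← hD, ← inner_self_eq_norm_sq (𝕜 := ℂ), ← ContinuousLinearMap.adjoint_inner_left, hsa,
    ← mul_apply_eq_comp, CFC.sqrt_mul_sqrt_self D hpos]

/-- The case of Leech's factorization theorem for multi-analytic operators in which the right-hand
side is a multiple of the identity.  With `R R^* ≥ c²` and `M^* M = R R^* - c²`, the identity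
`‖M h‖² + ‖c h_1‖² = ∑ ‖M S_i^* h‖² + ‖(R^* h)_1‖²` produces a contractive transition map of a
linear system.  Run on the input `R^* h`, that system passes through the states `M S_α^* h` and
returns `c h`, so its transfer operator `C` satisfies `C R^* = c`, and `Y = c⁻¹ C^*`. -/
theorem IsMultiAnalytic.exists_rightInverse {m : ℕ} {E : Type u} {F : Type v}
    [NormedAddCommGroup E] [InnerProductSpace ℂ E] [CompleteSpace E]
    [NormedAddCommGroup F] [InnerProductSpace ℂ F] [CompleteSpace F]
    {R : FockModule m E →L[ℂ] FockModule m F} (hR : IsMultiAnalytic R)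
    (hsurj : Function.Surjective R) :
    ∃ Y : FockModule m F →L[ℂ] FockModule m E, IsMultiAnalytic Y ∧ ∀ g, R (Y g) = g := by
  obtain ⟨c, hc, hRc⟩ := R.exists_norm_le_mul_norm_adjoint_of_surjective hsurj
  set T := ContinuousLinearMap.adjoint R with hTdef
  have hT : ∀ i f, T (annihilation i f) = annihilation i (T f) :=
    isMultiAnalytic_iff_adjoint.1 hR
  obtain ⟨M, hM⟩ := T.exists_norm_sq_eq_sub c hc.le hRc
  -- `U` sends `((M S_i^* h)_i, (R^* h)_1)` to `(M h, c h_1)`.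
  obtain ⟨U₁, U₂, hU, hU'⟩ := exists_contraction_pair_of_norm_sq_le (m := m)
    (LinearMap.pi fun i => (M ∘L annihilation i).toLinearMap) (coord 1 ∘L T).toLinearMap
    M.toLinearMap ((c : ℂ) • coord 1 : FockModule m F →L[ℂ] F).toLinearMap fun h => by
      have h1 := hM h
      have h2 := norm_sq_eq (T h)
      have h3 := norm_sq_eq h
      have h4 : ∑ i, ‖M (annihilation i h)‖ ^ 2 =
          ∑ i, ‖annihilation i (T h)‖ ^ 2 - c ^ 2 * ∑ i, ‖annihilation i h‖ ^ 2 := by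
        rw [Finset.mul_sum, ← Finset.sum_sub_distrib]
        exact Finset.sum_congr rfl fun i _ => by rw [hM, hT]
      have h5 : ‖(c : ℂ) • h 1‖ ^ 2 = c ^ 2 * ‖h 1‖ ^ 2 := by
        rw [norm_smul, mul_pow, Complex.norm_real, Real.norm_eq_abs, sq_abs]
      change ‖M h‖ ^ 2 + ‖(c : ℂ) • h 1‖ ^ 2 ≤
        ∑ i, ‖M (annihilation i h)‖ ^ 2 + ‖(T h) 1‖ ^ 2
      rw [h5, h4, h1, h2, h3]
      exact le_of_eq (by ring)
  obtain ⟨C, hC, hlim⟩ := exists_transferOperator U₁ U₂ hU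
  -- The states of `h` beyond its degree vanish, which matches the zero state of the system there.
  have key : ∀ n, ∀ h ∈ degreeLT n, (truncatedSystem U₁ U₂ n).1 (T h) = M h ∧
      (truncatedSystem U₁ U₂ n).2 (T h) = (c : ℂ) • h := by
    intro n
    induction n with
    | zero =>
      intro h hh
      rw [eq_zero_of_mem_degreeLT_zero hh]
      simp
    | succ n ih =>
      intro h hh
      have h1 := fun i => (ih _ (annihilation_mem_degreeLT hh i)).1
      have h2 := fun i => (ih _ (annihilation_mem_degreeLT hh i)).2
      rw [truncatedSystem_succ_fst, truncatedSystem_succ_snd]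
      simp only [← hT, h1, h2]
      refine ⟨(hU' h).1, ?_⟩
      have h3 : U₂ (fun i => M (annihilation i h), (T h) 1) = (c : ℂ) • h 1 := (hU' h).2
      rw [h3]
      conv_rhs => rw [← monomial_add_sum_creation h]
      simp only [map_smul, smul_add, Finset.smul_sum]
  have hCT : ∀ h, C (T h) = (c : ℂ) • h := by
    refine fun h => dense_iUnion_degreeLT.induction (fun h hh => ?_)
      (isClosed_eq (by fun_prop) (by fun_prop)) h
    obtain ⟨N, hN⟩ := Set.mem_iUnion.1 hh
    refine tendsto_nhds_unique (hlim (T h)) (tendsto_const_nhds.congr' ?_)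
    filter_upwards [Filter.eventually_ge_atTop N] with n hn
    exact ((key n h fun w hw => hN w (hn.trans hw)).2).symm
  refine ⟨ContinuousLinearMap.adjoint ((c : ℂ)⁻¹ • C), ?_, fun g => ext_inner_left ℂ fun h => ?_⟩
  · rw [isMultiAnalytic_iff_adjoint]
    intro i f
    simp [hC]
  · rw [← ContinuousLinearMap.adjoint_inner_left, ← hTdef,
      ContinuousLinearMap.adjoint_inner_right, smul_apply, hCT,
      inv_smul_smul₀ (by exact_mod_cast hc.ne')]

/-! ### Wold decomposition of submodules -/

namespace FockModule

variable {m : ℕ} {E : Type u} [NormedAddCommGroup E] [InnerProductSpace ℂ E]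

/-- The isometry `S_α ⊗ I_E = S_{i_1} ⋯ S_{i_k} ⊗ I_E` of a word `α = g_{i_1} ⋯ g_{i_k}`. -/
noncomputable def creationWord : Words m →* (FockModule m E →ₗᵢ[ℂ] FockModule m E) :=
  FreeMonoid.lift creation

theorem creationWord_one (f : FockModule m E) : creationWord 1 f = f := by
  rw [map_one]
  rfl

theorem creationWord_of_mul (i : Fin m) (w : Words m) (f : FockModule m E) :
    creationWord (FreeMonoid.of i * w) f = creation i (creationWord w f) := by
  rw [map_mul, creationWord, FreeMonoid.lift_eval_of]
  rfl

theorem creationWord_mem {K : Submodule ℂ (FockModule m E)}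
    (hK : ∀ i, ∀ k ∈ K, creation i k ∈ K) (w : Words m) {k : FockModule m E} (hk : k ∈ K) :
    creationWord w k ∈ K := by
  induction w using FreeMonoid.inductionOn' with
  | one => rwa [creationWord_one]
  | of_mul i w ih =>
    rw [creationWord_of_mul]
    exact hK i _ ih

/-- The wandering subspace `K ⊖ ∑ S_i K` of a submodule `K` of `F²_m ⊗ E`. -/
noncomputable def wanderingSubspace (K : Submodule ℂ (FockModule m E)) :
    Submodule ℂ (FockModule m E) :=
  K ⊓ ⨅ i : Fin m, (K.map (creation i).toLinearMap)ᗮ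

theorem mem_wanderingSubspace {K : Submodule ℂ (FockModule m E)} {x : FockModule m E} :
    x ∈ wanderingSubspace K ↔ x ∈ K ∧ ∀ i, ∀ k ∈ K, ⟪creation i k, x⟫_ℂ = 0 := by
  rw [wanderingSubspace, Submodule.mem_inf, Submodule.mem_iInf]
  refine and_congr_right fun _ => forall_congr' fun i => ?_
  rw [Submodule.mem_orthogonal]
  exact ⟨fun h k hk => h _ ⟨k, hk, rfl⟩, by rintro h _ ⟨k, hk, rfl⟩; exact h k hk⟩

theorem isClosed_wanderingSubspace {K : Submodule ℂ (FockModule m E)}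
    (hK : IsClosed (K : Set (FockModule m E))) :
    IsClosed (wanderingSubspace K : Set (FockModule m E)) := by
  rw [wanderingSubspace, Submodule.coe_inf, Submodule.coe_iInf]
  exact hK.inter (isClosed_iInter fun i => Submodule.isClosed_orthogonal _)

variable [CompleteSpace E]

theorem inner_creationWord_wanderingSubspace {K : Submodule ℂ (FockModule m E)}
    (hK : ∀ i, ∀ k ∈ K, creation i k ∈ K) {v w : Words m} (hvw : v ≠ w) {x y : FockModule m E}
    (hx : x ∈ wanderingSubspace K) (hy : y ∈ wanderingSubspace K) :
    ⟪creationWord v x, creationWord w y⟫_ℂ = 0 := by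
  rw [mem_wanderingSubspace] at hx hy
  induction v using FreeMonoid.inductionOn' generalizing w with
  | one =>
    rcases words_cases w with rfl | ⟨j, w, rfl⟩
    · exact absurd rfl hvw
    · rw [creationWord_one, creationWord_of_mul, inner_eq_zero_symm]
      exact hx.2 j _ (creationWord_mem hK w hy.1)
  | of_mul i v ih =>
    rcases words_cases w with rfl | ⟨j, w, rfl⟩
    · rw [creationWord_one, creationWord_of_mul]
      exact hy.2 i _ (creationWord_mem hK v hx.1)
    · rw [creationWord_of_mul, creationWord_of_mul]
      by_cases hij : i = j
      · subst hij
        rw [LinearIsometry.inner_map_map]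
        exact ih fun h => hvw (h ▸ rfl)
      · rw [← inner_annihilation_right, annihilation_creation_of_ne (Ne.symm hij), inner_zero_right]

/-- An element `k` of a closed submodule `K` differs from an element of its wandering subspace by
`∑ S_i k_i`, where `k_i ∈ K` is the projection of `S_i^* k`. -/
theorem sub_sum_creation_mem_wanderingSubspace (K : Submodule ℂ (FockModule m E))
    [K.HasOrthogonalProjection] (hK : ∀ i, ∀ k ∈ K, creation i k ∈ K) {k : FockModule m E}
    (hk : k ∈ K) :
    k - ∑ i, creation i (K.starProjection (annihilation i k)) ∈ wanderingSubspace K := by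
  rw [mem_wanderingSubspace]
  refine ⟨K.sub_mem hk (K.sum_mem fun i _ => hK i _ (K.starProjection_apply_mem _)),
    fun j l hl => ?_⟩
  rw [← inner_annihilation_right, map_sub, annihilation_sum_creation]
  exact K.inner_right_of_mem_orthogonal hl (K.sub_starProjection_mem_orthogonal _)

/-- There is no part of `K` outside the translates of the wandering subspace.  Such a `k` equals
`∑ S_i k_i` with `k_i = S_i^* k ∈ K` again orthogonal to all translates; so its coordinate at the
empty word vanishes, and inductively all its coordinates do. -/
theorem eq_zero_of_inner_creationWord_eq_zero (K : Submodule ℂ (FockModule m E))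
    [K.HasOrthogonalProjection] (hK : ∀ i, ∀ k ∈ K, creation i k ∈ K) {k : FockModule m E}
    (hk : k ∈ K) (h : ∀ v, ∀ x ∈ wanderingSubspace K, ⟪creationWord v x, k⟫_ℂ = 0) : k = 0 := by
  ext w
  change k w = 0
  -- An element of `K` orthogonal to the wandering subspace is its own shifted part.
  have hsum : ∀ l ∈ K, (∀ x ∈ wanderingSubspace K, ⟪x, l⟫_ℂ = 0) →
      l = ∑ i, creation i (K.starProjection (annihilation i l)) := by
    intro l hl hl'
    have hx := sub_sum_creation_mem_wanderingSubspace K hK hl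
    set x := l - ∑ i, creation i (K.starProjection (annihilation i l)) with hxdef
    have : ⟪x, x⟫_ℂ = 0 := by
      nth_rw 2 [hxdef]
      rw [inner_sub_right, hl' x hx, inner_sum, zero_sub, neg_eq_zero]
      refine Finset.sum_eq_zero fun i _ => ?_
      rw [inner_eq_zero_symm]
      exact (mem_wanderingSubspace.1 hx).2 i _ (K.starProjection_apply_mem _)
    exact sub_eq_zero.1 (inner_self_eq_zero.1 this)
  induction w using FreeMonoid.inductionOn' generalizing k with
  | one =>
    rw [hsum k hk fun x hx => by simpa only [creationWord_one] using h 1 x hx,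
      sum_creation_apply_one]
  | of_mul i w ih =>
    have hi : annihilation i k = K.starProjection (annihilation i k) := by
      nth_rw 1 [hsum k hk fun x hx => by simpa only [creationWord_one] using h 1 x hx,
        annihilation_sum_creation]
    rw [← annihilation_apply]
    refine ih (hi ▸ K.starProjection_apply_mem _) fun v x hx => ?_
    rw [inner_annihilation_right, ← creationWord_of_mul]
    exact h _ x hx

/-- The Beurling–Lax–Popescu theorem: by the Wold decomposition, a closed submodule of
`F²_m ⊗ E` is the image of a free module `F²_m ⊗ W` under an isometric module map. -/
theorem exists_isometry_range_eq (K : Submodule ℂ (FockModule m E))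
    (hKc : IsClosed (K : Set (FockModule m E))) (hK : ∀ i, ∀ k ∈ K, creation i k ∈ K) :
    ∃ (W : Submodule ℂ (FockModule m E)) (_ : CompleteSpace W)
      (V : FockModule m W →ₗᵢ[ℂ] FockModule m E),
      (∀ i f, V (creation i f) = creation i (V f)) ∧ ∀ k, k ∈ K ↔ ∃ f, V f = k := by
  have : CompleteSpace K := hKc.completeSpace_coe
  have hWc : CompleteSpace (wanderingSubspace K) :=
    (isClosed_wanderingSubspace hKc).completeSpace_coe
  have hV : OrthogonalFamily ℂ (fun _ : Words m => wanderingSubspace K)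
      fun w => (creationWord w).comp (wanderingSubspace K).subtypeₗᵢ :=
    fun v w hvw x y => inner_creationWord_wanderingSubspace hK hvw x.2 y.2
  let V : FockModule m (wanderingSubspace K) →ₗᵢ[ℂ] FockModule m E := hV.linearIsometry
  have hVsum : ∀ f, HasSum (fun w => creationWord w (f w : FockModule m E)) (V f) :=
    fun f => hV.hasSum_linearIsometry f
  have hVmon : ∀ w x, V (monomial w x) = creationWord w (x : FockModule m E) := fun w x => by
    classical
    exact hV.linearIsometry_apply_single (i := w) x
  have hVK : ∀ f, V f ∈ K := fun f =>
    hKc.mem_of_tendsto (hVsum f) <| Filter.Eventually.of_forall fun s =>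
      K.sum_mem fun w _ => creationWord_mem hK w (mem_wanderingSubspace.1 (f w).2).1
  refine ⟨wanderingSubspace K, hWc, V, fun i f => ?_, fun k => ⟨fun hk => ?_, ?_⟩⟩
  · have h1 := (hasSum_monomial f).map (V.comp (creation i)) (V.comp (creation i)).continuous
    have h2 := (hasSum_monomial f).map ((creation i).comp V) ((creation i).comp V).continuous
    refine h1.unique ?_
    convert! h2 using 1
    ext1 w
    change V (creation i (monomial w (f w))) = creation i (V (monomial w (f w)))
    rw [creation_monomial, hVmon, hVmon, creationWord_of_mul]
  · -- `k - V (V' k)` lies in `K` and is orthogonal to all translates of the wandering subspace.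
    let V' := ContinuousLinearMap.adjoint V.toContinuousLinearMap
    have hV' : ∀ f g, ⟪V f, g⟫_ℂ = ⟪f, V' g⟫_ℂ := fun f g =>
      (ContinuousLinearMap.adjoint_inner_right V.toContinuousLinearMap f g).symm
    refine ⟨V' k, (sub_eq_zero.1 ?_).symm⟩
    refine eq_zero_of_inner_creationWord_eq_zero K hK (K.sub_mem hk (hVK _)) fun w x hx => ?_
    rw [← hVmon w ⟨x, hx⟩, inner_sub_right, hV', V.inner_map_map, sub_self]
  · rintro ⟨f, rfl⟩
    exact hVK f

end FockModule

/-! ### Similarity of the quotient module -/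

section Quotient

variable {m : ℕ}
    {E : Type u} [NormedAddCommGroup E] [InnerProductSpace ℂ E]
    {E' : Type v} [NormedAddCommGroup E'] [InnerProductSpace ℂ E'] [CompleteSpace E']
    {Θ : FockModule m E →L[ℂ] FockModule m E'}

/-- If `Ψ Θ = 1`, then `ran Θ` is complemented by the submodule `ker Ψ`, which is therefore similar
to the quotient, and `ker Ψ` is a free module by `FockModule.exists_isometry_range_eq`. -/
theorem IsMultiAnalytic.exists_similar_of_leftInverse (hΘ : IsMultiAnalytic Θ)
    {Ψ : FockModule m E' →L[ℂ] FockModule m E} (hΨ : IsMultiAnalytic Ψ)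
    (hΨΘ : ∀ f, Ψ (Θ f) = f) :
    ∃ (F : Type v) (_ : NormedAddCommGroup F) (_ : InnerProductSpace ℂ F) (_ : CompleteSpace F),
      ModulesSimilar
        (fun i : Fin m => quotientOperator (LinearMap.range Θ.toLinearMap)
          (FockModule.creation i).toContinuousLinearMap (hΘ.creation_mem_range i))
        (fun i : Fin m => (FockModule.creation (E := F) i).toContinuousLinearMap) := by
  let N := LinearMap.range Θ.toLinearMap
  obtain ⟨W, hW, V, hVS, hVK⟩ := exists_isometry_range_eq (LinearMap.ker Ψ.toLinearMap)
    Ψ.isClosed_ker fun i k hk => by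
      change Ψ (creation i k) = 0
      rw [isMultiAnalytic_iff.1 hΨ, show Ψ k = 0 from hk, map_zero]
  have hΨV : ∀ f, Ψ (V f) = 0 := fun f => (hVK (V f)).2 ⟨f, rfl⟩
  let V' := ContinuousLinearMap.adjoint V.toContinuousLinearMap
  have hV'V : ∀ f, V' (V f) = f := fun f => ext_inner_left ℂ fun g => by
    refine (ContinuousLinearMap.adjoint_inner_right V.toContinuousLinearMap g (V f)).trans ?_
    exact V.inner_map_map g f
  -- `1 - ΘΨ` is the projection onto `ker Ψ = ran V` along `ran Θ`.
  have hproj : ∀ h, ∃ f, V f = h - Θ (Ψ h) := fun h => (hVK _).1 <| by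
    change Ψ (h - Θ (Ψ h)) = 0
    rw [map_sub, hΨΘ, sub_self]
  -- `V'` inverts the isometry `V` on its range, so `A` is the projection read in `F²_m ⊗ W`.
  let A : FockModule m E' →L[ℂ] FockModule m W :=
    V' ∘L (ContinuousLinearMap.id ℂ (FockModule m E') - Θ ∘L Ψ)
  have hA : ∀ h f, V f = h - Θ (Ψ h) → A h = f := fun h f hf => by
    change V' (h - Θ (Ψ h)) = f
    rw [← hf, hV'V]
  have hAΘ : ∀ h ∈ N, A h = 0 := by
    rintro _ ⟨f, rfl⟩
    refine hA _ _ ?_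
    change V 0 = Θ f - Θ (Ψ (Θ f))
    rw [hΨΘ, map_zero, sub_self]
  let X : (FockModule m E' ⧸ N) →L[ℂ] FockModule m W :=
    { toLinearMap := N.liftQ A.toLinearMap hAΘ
      cont := continuous_quot_lift _ A.continuous }
  let X' : FockModule m W →L[ℂ] (FockModule m E' ⧸ N) :=
    { toLinearMap := N.mkQ ∘ₗ V.toLinearMap
      cont := continuous_quot_mk.comp V.continuous }
  refine ⟨W, inferInstance, inferInstance, hW,
    ContinuousLinearEquiv.equivOfInverse X X' (fun q => ?_) (fun f => ?_), fun i q => ?_⟩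
  · obtain ⟨h, rfl⟩ := N.mkQ_surjective q
    obtain ⟨f, hf⟩ := hproj h
    change N.mkQ (V (A h)) = N.mkQ h
    rw [hA h f hf, hf, map_sub, sub_eq_self]
    exact (Submodule.Quotient.mk_eq_zero N).2 ⟨Ψ h, rfl⟩
  · refine hA (V f) f ?_
    rw [hΨV, map_zero, sub_zero]
  · obtain ⟨h, rfl⟩ := N.mkQ_surjective q
    obtain ⟨f, hf⟩ := hproj h
    change A (creation i h) = creation i (A h)
    rw [hA h f hf]
    refine hA _ _ ?_
    rw [hVS, hf, map_sub, isMultiAnalytic_iff.1 hΨ, isMultiAnalytic_iff.1 hΘ]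

variable [CompleteSpace E]

/-- A similarity of the quotient with a free module, composed with the quotient map, is a
surjective multi-analytic operator `R` with kernel `ran Θ`.  A multi-analytic right inverse `Y` of
`R` gives the multi-analytic projection `1 - YR` onto `ran Θ`, and `Ψ = Θ⁻¹ (1 - YR)`. -/
theorem IsMultiAnalytic.exists_mul_mul_eq_of_similar (hΘ : IsMultiAnalytic Θ)
    (hker : LinearMap.ker Θ.toLinearMap = ⊥)
    (hran : IsClosed (LinearMap.range Θ.toLinearMap : Set (FockModule m E')))
    {F : Type v} [NormedAddCommGroup F] [InnerProductSpace ℂ F] [CompleteSpace F]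
    (h : ModulesSimilar
        (fun i : Fin m => quotientOperator (LinearMap.range Θ.toLinearMap)
          (FockModule.creation i).toContinuousLinearMap (hΘ.creation_mem_range i))
        (fun i : Fin m => (FockModule.creation (E := F) i).toContinuousLinearMap)) :
    ∃ Ψ : FockModule m E' →L[ℂ] FockModule m E, IsMultiAnalytic Ψ ∧ Θ ∘L Ψ ∘L Θ = Θ := by
  obtain ⟨X, hX⟩ := h
  have hinj : Function.Injective Θ := LinearMap.ker_eq_bot.1 hker
  let R : FockModule m E' →L[ℂ] FockModule m F :=
    { toLinearMap := X.toLinearMap ∘ₗ (LinearMap.range Θ.toLinearMap).mkQ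
      cont := X.continuous.comp continuous_quot_mk }
  have hR : IsMultiAnalytic R := isMultiAnalytic_iff.2 fun i f =>
    hX i (Submodule.Quotient.mk f)
  have hRker : ∀ h, R h = 0 ↔ h ∈ LinearMap.range Θ.toLinearMap := fun h => by
    change X (Submodule.Quotient.mk h) = 0 ↔ _
    rw [map_eq_zero_iff X X.injective, Submodule.Quotient.mk_eq_zero]
  obtain ⟨Y, hY, hRY⟩ := hR.exists_rightInverse
    (X.surjective.comp (Submodule.mkQ_surjective _))
  let P : FockModule m E' →L[ℂ] FockModule m E' := ContinuousLinearMap.id ℂ _ - Y ∘L R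
  have hP : ∀ h, P h = h - Y (R h) := fun h => rfl
  have hPmem : ∀ h, P h ∈ Θ.range := fun h => (hRker _).1 <| by
    rw [hP, map_sub, hRY, sub_self]
  let Ψ : FockModule m E' →L[ℂ] FockModule m E :=
    (Θ.equivRange hinj hran).symm.toContinuousLinearMap ∘L P.codRestrict _ hPmem
  have hΘΨ : ∀ h, Θ (Ψ h) = h - Y (R h) := fun h =>
    congrArg Subtype.val ((Θ.equivRange hinj hran).apply_symm_apply ⟨P h, hPmem h⟩)
  refine ⟨Ψ, isMultiAnalytic_iff.2 fun i f => hinj ?_, ContinuousLinearMap.ext fun f => ?_⟩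
  · rw [isMultiAnalytic_iff.1 hΘ, hΘΨ, hΘΨ, map_sub, isMultiAnalytic_iff.1 hR,
      isMultiAnalytic_iff.1 hY]
  · change Θ (Ψ (Θ f)) = Θ f
    rw [hΘΨ, (hRker (Θ f)).2 ⟨f, rfl⟩, map_zero, sub_zero]

end Quotient

theorem mainTheorem4 {m : ℕ}
    {E : Type u} [NormedAddCommGroup E] [InnerProductSpace ℂ E] [CompleteSpace E]
    {E' : Type v} [NormedAddCommGroup E'] [InnerProductSpace ℂ E'] [CompleteSpace E']
    (Θ : FockModule m E →L[ℂ] FockModule m E') (hΘ : IsMultiAnalytic Θ)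
    (hker : LinearMap.ker Θ.toLinearMap = ⊥)
    (hran : IsClosed (LinearMap.range Θ.toLinearMap : Set (FockModule m E'))) :
    (∃ (F : Type v) (_ : NormedAddCommGroup F) (_ : InnerProductSpace ℂ F)
        (_ : CompleteSpace F),
      ModulesSimilar
        (fun i : Fin m => quotientOperator (LinearMap.range Θ.toLinearMap)
          (FockModule.creation i).toContinuousLinearMap (hΘ.creation_mem_range i))
        (fun i : Fin m =>
          (FockModule.creation (E := F) i).toContinuousLinearMap)) ↔
    ∃ Ψ : FockModule m E' →L[ℂ] FockModule m E,
      IsMultiAnalytic Ψ ∧ Θ ∘L Ψ ∘L Θ = Θ := by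
  refine ⟨fun ⟨F, _, _, _, h⟩ => hΘ.exists_mul_mul_eq_of_similar hker hran h,
    fun ⟨Ψ, hΨ, h⟩ => hΘ.exists_similar_of_leftInverse hΨ fun f => ?_⟩
  exact LinearMap.ker_eq_bot.1 hker (DFunLike.congr_fun h f)
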